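/- Let $L_1,L_2\ge 1$ be integers and let $J,h,\beta>0$ be real numbers with $$h<\frac{2J}{L_1}+\frac{2J}{L_2}.$$ Split $\mathbb Z^2$ into the cells $C(n,m)=\{t: nL_1\le t_1<(n+1)L_1,\ mL_2\le t_2<(m+1)L_2\}$, and let the external field $h(t)$ be $h$ on the cells with $n+m$ even and $-h$ on the others. For even $N\ge 2$ let $\mathbb T_N=\mathbb Z^2/(NL_1\mathbb Z\times NL_2\mathbb Z)$ and $\Omega_N=\{-1,+1\}^{\mathbb T_N}$; the field has the periods of $\mathbb T_N$. Let $\mu_{\beta,N}$ be the Gibbs measure on $\Omega_N$, $\mu_{\beta,N}(\sigma)=e^{-\beta H_N(\sigma)}/Z_N(\beta)$, with the periodic Hamiltonian $$H_N(\sigma)=-J\sum_{s\in\mathbb T_N}\bigl(\sigma(s)\sigma(s+e_1)+\sigma(s)\sigma(s+e_2)\bigr)-\sum_{s\in\mathbb T_N}h(s)\sigma(s)$$ (every nearest-neighbour bond is counted once; if $NL_i=2$, the sites $s$ and $s+e_i$ are joined by two bonds). Let $\Lambda\subset\mathbb T_N$ be the image of $\{t\in\mathbb Z^2:|t_1+\frac12|\le\frac{L_1}2,\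 |t_2+\frac12|\le\frac{L_2}2\}$, a block of $B_1B_2$ sites, where $B_i=L_i$ if $L_i$ is even and $B_i=L_i+1$ if $L_i$ is odd. For a set $V$ of sites let $\mathcal R_V$ be the event that $\sigma$ is not constant on $V$. Let $\widetilde{\mathbb T}_N=\{(nL_1,mL_2)\}\subset\mathbb T_N$. For $\mathbf t=(nL_1,mL_2)$ let $\pi_{\mathbf t}:\Omega_N\to\Omega_N$ be the following operator: reflect the configuration in the line $t_1=-\frac12$ if $n$ is odd and in the line $t_2=-\frac12$ if $m$ is odd (these lines bisect $\Lambda$), then translate it by $\mathbf t$. For an event $\mathcal A$ put $$\mathfrak z_{\beta,N}(\mathcal A)=\mu_{\beta,N}\Bigl(\bigcap_{\mathbf t\in\widetilde{\mathbb T}_N}\pi_{\mathbf t}(\mathcal A)\Bigr)^{1/|\widetilde{\mathbb T}_N|}.$$ Then for every even $N\ge2$ $$\mathfrak z_{\beta,N}(\mathcal R_\Lambda)\le 2^{B_1B_2}\exp\Bigl\{-\beta\Bigl(2J-\frac{hL_1L_2}{L_1+L_2}\Bigr)\Bigr\}.$$ Define further the double-blocks $\Lambda^*_{h,1}=\Lambda\cup(\Lambda+(L_1,0))$,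 $\Lambda^*_{h,2}=\Lambda\cup(\Lambda-(L_1,0))$, $\Lambda^*_{v,1}=\Lambda\cup(\Lambda+(0,L_2))$, $\Lambda^*_{v,2}=\Lambda\cup(\Lambda-(0,L_2))$, and the sets of positions $\widetilde{\mathbb T}^{(h,1)}_N=\{(2nL_1,mL_2)\}$, $\widetilde{\mathbb T}^{(h,2)}_N=\{((2n-1)L_1,mL_2)\}$, $\widetilde{\mathbb T}^{(v,1)}_N=\{(nL_1,2mL_2)\}$, $\widetilde{\mathbb T}^{(v,2)}_N=\{(nL_1,(2m-1)L_2)\}$ in $\mathbb T_N$ (with $n,m\in\mathbb Z$; here the letters $h$ and $v$ stand for horizontal and vertical). Let $4\mid N$, $N\ge4$. For $d\in\{h,v\}$ and $i,j\in\{1,2\}$ let $\pi^{*(d,i,j)}_{\mathbf t}$, for $\mathbf t\in\widetilde{\mathbb T}^{(d,j)}_N$ with indices $n,m$ as displayed, be the operator that reflects a configuration in the vertical line bisecting $\Lambda^*_{d,i}$ if $n$ is odd and in the horizontal line bisecting it if $m$ is odd, and then translates it by $\mathbf t$; put $$\mathfrak z^{(d,i,j)}_{\beta,N}(\mathcal A)=\mu_{\beta,N}\Bigl(\bigcap_{\mathbf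 t\in\widetilde{\mathbb T}^{(d,j)}_N}\pi^{*(d,i,j)}_{\mathbf t}(\mathcal A)\Bigr)^{1/|\widetilde{\mathbb T}^{(d,j)}_N|},$$ and $\mathfrak z^{(k)}_{\beta,N}=\mathfrak z^{(d,i,i)}_{\beta,N}$ for $k=(d,i)$. Then for every $N\ge 4$ that is a multiple of $4$ and all $d\in\{h,v\}$, $i,j\in\{1,2\}$, $$\mathfrak z^{(d,i,j)}_{\beta,N}(\mathcal R_{\Lambda^*_{d,i}})\le 4^{B_1B_2}\exp\Bigl\{-\beta\Bigl(2J-\frac{hL_1L_2}{L_1+L_2}\Bigr)\Bigr\};$$ in particular $\mathfrak z^{(k)}_{\beta,N}(\mathcal R_{\Lambda^*_k})$ satisfies this bound for every $k\in\{(h,1),(h,2),(v,1),(v,2)\}$. -/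

import Mathlib

namespace CellBoard

noncomputable section

/-! The cell-board Ising model on `ℤ²` and on the discrete torus. -/

/-- The rectangular cell `C(n, m)` of size `L₁ × L₂`. -/
def cell (L₁ L₂ : ℕ) (n m : ℤ) : Set (ℤ × ℤ) :=
  {t | n * L₁ ≤ t.1 ∧ t.1 < (n + 1) * L₁ ∧ m * L₂ ≤ t.2 ∧ t.2 < (m + 1) * L₂}

/-- The union of the cells `C(n, m)` with `n + m` even (the white sites). -/
def Zplus (L₁ L₂ : ℕ) : Set (ℤ × ℤ) :=
  {t | ∃ n m : ℤ, Even (n + m) ∧ t ∈ cell L₁ L₂ n m}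

open Classical in
/-- The external field on `ℤ²`: `h` on the white sites and `-h` on the black ones. -/
def field (L₁ L₂ : ℕ) (h : ℝ) (t : ℤ × ℤ) : ℝ :=
  if t ∈ Zplus L₁ L₂ then h else -h

/-- The discrete torus `ℤ² / (N L₁ ℤ × N L₂ ℤ)`. -/
abbrev Torus (L₁ L₂ N : ℕ) : Type := ZMod (N * L₁) × ZMod (N * L₂)

/-- The quotient map from `ℤ²` onto the torus. -/
def toTorus (L₁ L₂ N : ℕ) (t : ℤ × ℤ) : Torus L₁ L₂ N :=
  ((t.1 : ZMod (N * L₁)), (t.2 : ZMod (N * L₂)))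

/-- Configurations on the torus; `ℤˣ` is the set `{-1, +1}` of spin values. -/
abbrev Config (L₁ L₂ N : ℕ) : Type := Torus L₁ L₂ N → ℤˣ

/-- The value of a spin as a real number. -/
def spinVal (u : ℤˣ) : ℝ := ((u : ℤ) : ℝ)

/-- The external field on the torus, read off at the representative of a site in
`[0, N L₁) × [0, N L₂)`; for even `N` the field on `ℤ²` has these periods. -/
def torusField (L₁ L₂ N : ℕ) (h : ℝ) (s : Torus L₁ L₂ N) : ℝ :=
  field L₁ L₂ h ((s.1.val : ℤ), (s.2.val : ℤ))

/-- The Hamiltonian with periodic boundary conditions. Every nearest neighbour bond is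
written once, as `{s, s + e₁}` or `{s, s + e₂}`; thus on a cycle of length two the two
sites are joined by two bonds. -/
def hamiltonian (L₁ L₂ N : ℕ) [NeZero L₁] [NeZero L₂] [NeZero N] (J h : ℝ)
    (σ : Config L₁ L₂ N) : ℝ :=
  -J * ∑ s : Torus L₁ L₂ N,
      (spinVal (σ s) * spinVal (σ (s + (1, 0))) + spinVal (σ s) * spinVal (σ (s + (0, 1))))
    - ∑ s : Torus L₁ L₂ N, torusField L₁ L₂ N h s * spinVal (σ s)

/-- The partition function. -/
def partitionFn (L₁ L₂ N : ℕ) [NeZero L₁] [NeZero L₂] [NeZero N] (J h β : ℝ) : ℝ :=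
  ∑ σ : Config L₁ L₂ N, Real.exp (-β * hamiltonian L₁ L₂ N J h σ)

/-- The Gibbs weight of a configuration. -/
def gibbs (L₁ L₂ N : ℕ) [NeZero L₁] [NeZero L₂] [NeZero N] (J h β : ℝ)
    (σ : Config L₁ L₂ N) : ℝ :=
  Real.exp (-β * hamiltonian L₁ L₂ N J h σ) / partitionFn L₁ L₂ N J h β

/-- The Gibbs probability of an event. -/
def gibbsProb (L₁ L₂ N : ℕ) [NeZero L₁] [NeZero L₂] [NeZero N] (J h β : ℝ)
    (A : Set (Config L₁ L₂ N)) : ℝ :=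
  ∑ σ : Config L₁ L₂ N, A.indicator (gibbs L₁ L₂ N J h β) σ

/-! Blocks and propagation. -/

/-- The block `Λ`: the sites with `|t_i + 1/2| ≤ L_i / 2` (written as `|2 t_i + 1| ≤ L_i`). -/
def block (L₁ L₂ N : ℕ) : Set (Torus L₁ L₂ N) :=
  toTorus L₁ L₂ N '' {t : ℤ × ℤ | |2 * t.1 + 1| ≤ (L₁ : ℤ) ∧ |2 * t.2 + 1| ≤ (L₂ : ℤ)}

/-- The side length `B_i` of the block, in sites. -/
def blockSide (L : ℕ) : ℕ := if Even L then L else L + 1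

/-- The translation operator `(τ_a σ)(s) = σ(s - a)`. -/
def translate (L₁ L₂ N : ℕ) (a : ℤ × ℤ) (σ : Config L₁ L₂ N) : Config L₁ L₂ N :=
  fun s => σ (s - toTorus L₁ L₂ N a)

/-- The reflection operator for the line `t₁ = c / 2`. -/
def reflect₁ (L₁ L₂ N : ℕ) (c : ℤ) (σ : Config L₁ L₂ N) : Config L₁ L₂ N :=
  fun s => σ ((c : ZMod (N * L₁)) - s.1, s.2)

/-- The reflection operator for the line `t₂ = c / 2`. -/
def reflect₂ (L₁ L₂ N : ℕ) (c : ℤ) (σ : Config L₁ L₂ N) : Config L₁ L₂ N :=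
  fun s => σ (s.1, (c : ZMod (N * L₂)) - s.2)

open Classical in
/-- The propagation operator with translation vector `a`, bisecting lines `t₁ = c.1 / 2` and
`t₂ = c.2 / 2`, and index `p`: the reflection in the `i`-th bisecting line is applied
exactly when the `i`-th index is odd, and then the translation. -/
def propagator (L₁ L₂ N : ℕ) (a c p : ℤ × ℤ) (σ : Config L₁ L₂ N) : Config L₁ L₂ N :=
  translate L₁ L₂ N a
    ((if Odd p.1 then reflect₁ L₁ L₂ N c.1 else id)
      ((if Odd p.2 then reflect₂ L₁ L₂ N c.2 else id) σ))

/-- The position `(n L₁, m L₂)` of the block with index `p = (n, m)`. -/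
def blockPos (L₁ L₂ : ℕ) (p : ℤ × ℤ) : ℤ × ℤ := (p.1 * L₁, p.2 * L₂)

/-- The set of all block positions on the torus. -/
def blockTorus (L₁ L₂ N : ℕ) : Set (Torus L₁ L₂ N) :=
  Set.range fun p : ℤ × ℤ => toTorus L₁ L₂ N (blockPos L₁ L₂ p)

/-- The propagation `π_t`, `t = (n L₁, m L₂)`, for blocks; `Λ` is bisected by the lines
`t₁ = -1/2` and `t₂ = -1/2`. For even `N` it depends only on `t` as a point of the torus. -/
def propagate (L₁ L₂ N : ℕ) (p : ℤ × ℤ) : Config L₁ L₂ N → Config L₁ L₂ N :=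
  propagator L₁ L₂ N (blockPos L₁ L₂ p) (-1, -1) p

/-- The quantity `𝔷_{β,N}(A)`. -/
def z (L₁ L₂ N : ℕ) [NeZero L₁] [NeZero L₂] [NeZero N] (J h β : ℝ)
    (A : Set (Config L₁ L₂ N)) : ℝ :=
  gibbsProb L₁ L₂ N J h β (⋂ p : ℤ × ℤ, propagate L₁ L₂ N p '' A)
    ^ (1 / ((blockTorus L₁ L₂ N).ncard : ℝ))

/-- The event that the configuration is not constant on `V`. -/
def badEvent (L₁ L₂ N : ℕ) (V : Set (Torus L₁ L₂ N)) : Set (Config L₁ L₂ N) :=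
  {σ | ¬ ((∀ s ∈ V, σ s = 1) ∨ (∀ s ∈ V, σ s = -1))}

/-! Double-blocks. -/

/-- The orientation of a double-block. -/
inductive Dir
  | horizontal
  | vertical

/-- The second label of a double-block, and of a family of double-block positions. -/
inductive Label
  | one
  | two

/-- The label `one` adds the neighbouring block on the positive side, `two` on the negative. -/
def Label.sign : Label → ℤ
  | .one => 1
  | .two => -1

/-- The label `one` stands for the positions `2 n L_i`, `two` for `(2 n - 1) L_i`. -/
def Label.offset : Label → ℤ
  | .one => 0
  | .two => 1

/-- The vector between the two blocks of the double-block with label `(d, i)`. -/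
def doubleShift (L₁ L₂ : ℕ) : Dir → Label → ℤ × ℤ
  | .horizontal, i => (i.sign * L₁, 0)
  | .vertical, i => (0, i.sign * L₂)

/-- The double-block `Λ*_{d,i}`, the union of `Λ` and of its translate. -/
def doubleBlock (L₁ L₂ N : ℕ) (d : Dir) (i : Label) : Set (Torus L₁ L₂ N) :=
  block L₁ L₂ N ∪
    (fun s => s + toTorus L₁ L₂ N (doubleShift L₁ L₂ d i)) '' block L₁ L₂ N

/-- Twice the coordinates of the lines that bisect `Λ*_{d,i}`. -/
def doubleCentre (L₁ L₂ : ℕ) (d : Dir) (i : Label) : ℤ × ℤ :=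
  (-1, -1) + doubleShift L₁ L₂ d i

/-- The position with index `p = (n, m)` in the family with label `(d, j)`:
`(2 n L₁, m L₂)`, `((2 n - 1) L₁, m L₂)`, `(n L₁, 2 m L₂)` or `(n L₁, (2 m - 1) L₂)`. -/
def doublePos (L₁ L₂ : ℕ) : Dir → Label → ℤ × ℤ → ℤ × ℤ
  | .horizontal, j, p => ((2 * p.1 - j.offset) * L₁, p.2 * L₂)
  | .vertical, j, p => (p.1 * L₁, (2 * p.2 - j.offset) * L₂)

/-- The set of all positions on the torus in the family with label `(d, j)`. -/
def doubleTorus (L₁ L₂ N : ℕ) (d : Dir) (j : Label) : Set (Torus L₁ L₂ N) :=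
  Set.range fun p : ℤ × ℤ => toTorus L₁ L₂ N (doublePos L₁ L₂ d j p)

/-- The propagation of the double-block `Λ*_{d,i}` over the positions of the family `(d, j)`:
`Λ*_{d,i}` is reflected in its own bisecting lines, according to the parities of the index.
If `4` divides `N`, it depends only on the position as a point of the torus. -/
def doublePropagate (L₁ L₂ N : ℕ) (d : Dir) (i j : Label) (p : ℤ × ℤ) :
    Config L₁ L₂ N → Config L₁ L₂ N :=
  propagator L₁ L₂ N (doublePos L₁ L₂ d j p) (doubleCentre L₁ L₂ d i) p

/-- The analogue of `𝔷_{β,N}(A)` for `Λ*_{d,i}`-events `A`, propagated over the family `(d, j)`;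
`𝔷^{(k)}` with `k = (d, i)` is the case `j = i`. -/
def zDouble (L₁ L₂ N : ℕ) [NeZero L₁] [NeZero L₂] [NeZero N] (J h β : ℝ)
    (d : Dir) (i j : Label) (A : Set (Config L₁ L₂ N)) : ℝ :=
  gibbsProb L₁ L₂ N J h β (⋂ p : ℤ × ℤ, doublePropagate L₁ L₂ N d i j p '' A)
    ^ (1 / ((doubleTorus L₁ L₂ N d j).ncard : ℝ))

end

end CellBoard

/-! Let `D` be the number of disagreeing bonds of a configuration and `κ = 2J - h L₁ L₂ / (L₁ +
L₂)`. Apart from the field, the energy is `-2J|𝕋| + 2J D`. The field changes sign under translation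
by `L₁ e₁` and by `L₂ e₂`, so its contribution only sees differences of spins at distance `L₁` (or
`L₂`), and these are paid for by disagreeing bonds in between. Averaging the two estimates with
weights proportional to `L₂` and `L₁` bounds the gain from the field by `h L₁ L₂ / (L₁ + L₂) * D`
(`sum_antiperiodic_le`, `sum_field_le`). Hence the energy is at least `-2J|𝕋| + κ D`
(`le_hamiltonian`).

If the bad event is propagated to all `n` positions, every translate of the block carries a
disagreement, and `D ≥ n` (`mul_le_bondCount`). Neighbouring blocks may share a row or column, so
bonds are counted with multiplicity two; a nonconstant rectangle then contributes at least two
(`two_le_rect_disagree`).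

A constant configuration of the favourable sign gives `Z ≥ exp(2βJ|𝕋|)`, and there are `2^|𝕋|`
configurations. The probability is thus at most `2^|𝕋| exp(-βκn)`. Taking the `n`-th root gives
`rect_bound`, which covers blocks and double-blocks alike. -/

namespace CellBoard

/-! Disagreements of spins. -/

/-- The indicator of the event that two spins disagree. -/
def disagree (a b : ℤˣ) : ℕ := if a = b then 0 else 1

theorem one_le_disagree {a b : ℤˣ} (hab : a ≠ b) : 1 ≤ disagree a b := by
  simp [disagree, hab]

theorem spinVal_mul (a b : ℤˣ) : spinVal a * spinVal b = 1 - 2 * (disagree a b : ℝ) := by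
  rcases Int.units_eq_one_or a with rfl | rfl <;> rcases Int.units_eq_one_or b with rfl | rfl <;>
    norm_num [spinVal, disagree]

theorem abs_spinVal_sub (a b : ℤˣ) : |spinVal a - spinVal b| = 2 * (disagree a b : ℝ) := by
  rcases Int.units_eq_one_or a with rfl | rfl <;> rcases Int.units_eq_one_or b with rfl | rfl <;>
    norm_num [spinVal, disagree]

theorem disagree_triangle (a b c : ℤˣ) : disagree a c ≤ disagree a b + disagree b c := by
  unfold disagree
  split_ifs <;> simp_all

theorem disagree_le_sum (u : ℕ → ℤˣ) (n : ℕ) :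
    disagree (u 0) (u n) ≤ ∑ k ∈ Finset.range n, disagree (u k) (u (k + 1)) := by
  induction n with
  | zero => simp [disagree]
  | succ n ih =>
    rw [Finset.sum_range_succ]
    exact (disagree_triangle _ (u n) _).trans (Nat.add_le_add_right ih _)

/-- One of the two values differs from `u 0`, and the path from `0` to that index contains a
disagreement. -/
theorem one_le_sum_disagree (u : ℕ → ℤˣ) {n x x' : ℕ} (hx : x ≤ n) (hx' : x' ≤ n)
    (hu : u x ≠ u x') : 1 ≤ ∑ k ∈ Finset.range n, disagree (u k) (u (k + 1)) := by
  have aux : ∀ y ≤ n, u 0 ≠ u y → 1 ≤ ∑ k ∈ Finset.range n, disagree (u k) (u (k + 1)) :=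
    fun y hy h0 => (one_le_disagree h0).trans <| (disagree_le_sum u y).trans <|
      Finset.sum_le_sum_of_subset (Finset.range_mono hy)
  by_cases h0 : u 0 = u x
  · exact aux x' hx' (h0 ▸ hu)
  · exact aux x hx h0

/-! Disagreements in a rectangle. -/

/-- The windows `[0, K)` and `[δ, K + δ)` together cover `[0, K + δ)`. Each of them is a full
period, which is what permits summation over the torus later. -/
theorem le_sum_windows (g : ℕ → ℕ) {K δ y : ℕ} (hK : 1 ≤ K) (hδ : δ ≤ 1) (hy : y < K + δ) :
    g y ≤ ∑ k ∈ Finset.range K, (g k + g (k + δ)) := by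
  by_cases hyK : y < K
  · exact (Nat.le_add_right _ _).trans
      (Finset.single_le_sum (f := fun k => g k + g (k + δ)) (fun _ _ => Nat.zero_le _)
        (Finset.mem_range.2 hyK))
  · obtain rfl : y = (K - 1) + δ := by omega
    exact (Nat.le_add_left _ _).trans
      (Finset.single_le_sum (f := fun k => g k + g (k + δ)) (fun _ _ => Nat.zero_le _)
        (Finset.mem_range.2 (by omega : K - 1 < K)))

theorem two_le_sum_windows (g : ℕ → ℕ) {K δ : ℕ} (hK : 1 ≤ K)
    (hg : ∀ y < K + δ, 1 ≤ g y) : 2 ≤ ∑ k ∈ Finset.range K, (g k + g (k + δ)) := by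
  have h1 := hg 0 (by omega)
  have h2 := hg (0 + δ) (by omega)
  have h3 := Finset.single_le_sum (f := fun k => g k + g (k + δ)) (fun _ _ => Nat.zero_le _)
        (Finset.mem_range.2 (by omega : 0 < K))
  omega

/-- A configuration that is not constant on a rectangle has two disagreeing bonds there, where
the bonds between inner sites are counted twice. -/
theorem two_le_rect_disagree (f : ℕ → ℕ → ℤˣ) {K₁ K₂ δ₁ δ₂ : ℕ} (hK₁ : 1 ≤ K₁) (hK₂ : 1 ≤ K₂)
    (hδ₁ : δ₁ ≤ 1) (hδ₂ : δ₂ ≤ 1) {x y x' y' : ℕ} (hx : x < K₁ + δ₁) (hy : y < K₂ + δ₂)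
    (hx' : x' < K₁ + δ₁) (hy' : y' < K₂ + δ₂) (hf : f x y ≠ f x' y') :
    2 ≤ (∑ y ∈ Finset.range K₂, ((∑ x ∈ Finset.range K₁, disagree (f x y) (f (x + 1) y)) +
            ∑ x ∈ Finset.range K₁, disagree (f x (y + δ₂)) (f (x + 1) (y + δ₂)))) +
        ∑ x ∈ Finset.range K₁, ((∑ y ∈ Finset.range K₂, disagree (f x y) (f x (y + 1))) +
            ∑ y ∈ Finset.range K₂, disagree (f (x + δ₁) y) (f (x + δ₁) (y + 1))) := by
  set H : ℕ → ℕ := fun y => ∑ x ∈ Finset.range K₁, disagree (f x y) (f (x + 1) y)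
  set V : ℕ → ℕ := fun x => ∑ y ∈ Finset.range K₂, disagree (f x y) (f x (y + 1))
  -- The last bond ends at column `K₁`, outside the rectangle if `δ₁ = 0`; a superfluous bond does
  -- no harm to a lower bound.
  have hH : ∀ {y x x'}, x < K₁ + δ₁ → x' < K₁ + δ₁ → f x y ≠ f x' y → 1 ≤ H y :=
    fun {y} _ _ h h' hne => one_le_sum_disagree (fun k => f k y) (by omega) (by omega) hne
  have hV : ∀ {x y y'}, y < K₂ + δ₂ → y' < K₂ + δ₂ → f x y ≠ f x y' → 1 ≤ V x :=
    fun {x} _ _ h h' hne => one_le_sum_disagree (fun k => f x k) (by omega) (by omega) hne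
  change 2 ≤ (∑ y ∈ Finset.range K₂, (H y + H (y + δ₂))) +
    ∑ x ∈ Finset.range K₁, (V x + V (x + δ₁))
  by_cases hall : ∀ y < K₂ + δ₂, 1 ≤ H y
  · exact (two_le_sum_windows H hK₂ hall).trans (Nat.le_add_right _ _)
  by_cases hallV : ∀ x < K₁ + δ₁, 1 ≤ V x
  · exact (two_le_sum_windows V hK₁ hallV).trans (Nat.le_add_left _ _)
  push Not at hall hallV
  obtain ⟨y₀, hy₀, hy₀'⟩ := hall
  obtain ⟨x₀, hx₀, hx₀'⟩ := hallV
  -- In the remaining case row `y₀` and column `x₀` are constant with a common value. A site `(u,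
  -- v)` with the other value makes both row `v` and column `u` nonconstant, so each kind of bond
  -- contributes one.
  have row : ∀ x < K₁ + δ₁, f x y₀ = f x₀ y₀ := fun x hx => by
    by_contra hne
    have := hH hx hx₀ hne
    omega
  have col : ∀ y < K₂ + δ₂, f x₀ y = f x₀ y₀ := fun y hy => by
    by_contra hne
    have := hV hy hy₀ hne
    omega
  obtain ⟨u, v, hu, hv, huv⟩ : ∃ u v, u < K₁ + δ₁ ∧ v < K₂ + δ₂ ∧ f u v ≠ f x₀ y₀ := by
    by_contra! hc
    exact hf ((hc x y hx hy).trans (hc x' y' hx' hy').symm)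
  have h1 : 1 ≤ H v := hH hu hx₀ (fun h => huv (h.trans (col v hv)))
  have h2 : 1 ≤ V u := hV hv hy₀ (fun h => huv (h.trans (row u hu)))
  have h3 := le_sum_windows H hK₂ hδ₂ hv
  have h4 := le_sum_windows V hK₁ hδ₁ hu
  omega

/-! Sums over cyclic groups and over the torus. -/

theorem sum_range_mul_eq {α : Type*} [AddCommMonoid α] (g : ℕ → α) (N K : ℕ) :
    ∑ i ∈ Finset.range (N * K), g i =
      ∑ n ∈ Finset.range N, ∑ k ∈ Finset.range K, g (n * K + k) := by
  induction N with
  | zero => simp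
  | succ N ih => rw [Nat.succ_mul, Finset.sum_range_add, ih, Finset.sum_range_succ]

theorem sum_zmod {α : Type*} [AddCommMonoid α] (M : ℕ) [NeZero M] (g : ZMod M → α) :
    ∑ s : ZMod M, g s = ∑ i ∈ Finset.range M, g (i : ZMod M) := by
  obtain ⟨m, rfl⟩ := Nat.exists_eq_succ_of_ne_zero (NeZero.ne M)
  rw [Finset.sum_range]
  refine Finset.sum_congr rfl fun s _ => ?_
  congr 1
  exact (ZMod.natCast_zmod_val (n := m + 1) s).symm

theorem sum_zmod_blocks {α : Type*} [AddCommMonoid α] {M N K : ℕ} [NeZero M] (hM : N * K = M)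
    (g : ZMod M → α) (c : ℤ) :
    ∑ s : ZMod M, g s = ∑ n ∈ Finset.range N, ∑ k ∈ Finset.range K,
      g (((n * K + c + k : ℤ)) : ZMod M) := by
  have hrange : Finset.range M = Finset.range (N * K) := by rw [hM]
  rw [← Equiv.sum_comp (Equiv.addRight (c : ZMod M)), sum_zmod, hrange, sum_range_mul_eq]
  refine Finset.sum_congr rfl fun n _ => Finset.sum_congr rfl fun k _ => ?_
  congr 1
  simp only [Equiv.coe_addRight]
  push_cast
  ring

theorem sum_torus_blocks {α : Type*} [AddCommMonoid α] {M₁ M₂ N₁ N₂ K₁ K₂ : ℕ} [NeZero M₁]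
    [NeZero M₂] (hM₁ : N₁ * K₁ = M₁) (hM₂ : N₂ * K₂ = M₂) (g : ZMod M₁ × ZMod M₂ → α)
    (c₁ c₂ : ℤ) :
    ∑ s, g s = ∑ n ∈ Finset.range N₁, ∑ m ∈ Finset.range N₂,
      ∑ x ∈ Finset.range K₁, ∑ y ∈ Finset.range K₂,
        g (((n * K₁ + c₁ + x : ℤ) : ZMod M₁), ((m * K₂ + c₂ + y : ℤ) : ZMod M₂)) := by
  rw [Fintype.sum_prod_type, sum_zmod_blocks hM₁ (fun s => ∑ t, g (s, t)) c₁]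
  refine Finset.sum_congr rfl fun n _ => ?_
  refine Eq.trans ?_ Finset.sum_comm
  refine Finset.sum_congr rfl fun x _ => ?_
  exact sum_zmod_blocks hM₂ (fun t => g (((n * K₁ + c₁ + x : ℤ) : ZMod M₁), t)) c₂

/-- Since `N * K = M`, the residue of `n * K + c` determines, and is determined by, `n` modulo `N`.
-/
theorem ncard_range_zmod {M N K : ℕ} [NeZero M] (hM : N * K = M) (c : ℤ) :
    (Set.range fun n : ℤ => ((n * K + c : ℤ) : ZMod M)).ncard = N := by
  have hM0 : M ≠ 0 := NeZero.ne M
  have hN : N ≠ 0 := by rintro rfl; simp at hM; exact hM0 hM.symm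
  have hK : K ≠ 0 := by rintro rfl; simp at hM; exact hM0 hM.symm
  have key : ∀ n n' : ℤ, ((n * K + c : ℤ) : ZMod M) = ((n' * K + c : ℤ) : ZMod M) ↔
      n ≡ n' [ZMOD N] := by
    intro n n'
    rw [ZMod.intCast_eq_intCast_iff, ← hM]
    constructor
    · intro h
      have h2 := Int.ModEq.add_right_cancel' c h
      push_cast at h2
      exact Int.ModEq.mul_right_cancel' (by exact_mod_cast hK) h2
    · intro h
      push_cast
      exact (h.mul_right').add_right c
  have himg : (Set.range fun n : ℤ => ((n * K + c : ℤ) : ZMod M)) =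
      (fun n : ℕ => (((n : ℤ) * K + c : ℤ) : ZMod M)) '' (Finset.range N : Set ℕ) := by
    ext s
    constructor
    · rintro ⟨n, rfl⟩
      refine ⟨(n % N).toNat, ?_, ?_⟩
      · have h1 := Int.emod_lt_of_pos n (by omega : (0 : ℤ) < N)
        simp
        omega
      · refine (key _ _).2 ?_
        rw [Int.toNat_of_nonneg (Int.emod_nonneg _ (by omega))]
        exact Int.mod_modEq _ _
    · rintro ⟨n, _, rfl⟩
      exact ⟨n, rfl⟩
  rw [himg, Set.InjOn.ncard_image, Set.ncard_coe_finset, Finset.card_range]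
  intro n hn n' hn' h
  have h1 := (key _ _).1 h
  have h2 := (Int.natCast_modEq_iff).1 h1
  simp at hn hn'
  exact Nat.ModEq.eq_of_lt_of_lt h2 hn hn'

/-! Disagreeing bonds on the torus. -/

/-- The number of disagreeing bonds `{s, s + e}`. -/
def bondCount {G : Type*} [Fintype G] [Add G] (e : G) (σ : G → ℤˣ) : ℕ :=
  ∑ s, disagree (σ s) (σ (s + e))

/-- A spin sum against a field that changes sign under the translation by `L • e` is bounded by
the number of disagreeing bonds in direction `e`. -/
theorem sum_antiperiodic_le {G : Type*} [Fintype G] [AddCommGroup G] (e : G) (L : ℕ) (φ : G → ℝ)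
    {h : ℝ} (hφ : ∀ s, |φ s| ≤ h) (hanti : ∀ s, φ (s + L • e) = -φ s) (σ : G → ℤˣ) :
    ∑ s, φ s * spinVal (σ s) ≤ h * (L * bondCount e σ) := by
  -- Averaging the sum with its translate turns the spins into spin differences; each is then
  -- telescoped along the `L` bonds of a segment.
  have hshift : ∑ s, φ s * spinVal (σ s) = -∑ s, φ s * spinVal (σ (s + L • e)) := by
    rw [← Equiv.sum_comp (Equiv.addRight (L • e)), ← Finset.sum_neg_distrib]
    refine Finset.sum_congr rfl fun s _ => ?_
    simp only [Equiv.coe_addRight, hanti, neg_mul]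
  have hdouble : 2 * ∑ s, φ s * spinVal (σ s) =
      ∑ s, φ s * (spinVal (σ s) - spinVal (σ (s + L • e))) := by
    simp only [mul_sub, Finset.sum_sub_distrib]
    linarith
  have hterm : ∀ s, φ s * (spinVal (σ s) - spinVal (σ (s + L • e))) ≤
      h * (2 * ∑ k ∈ Finset.range L, (disagree (σ (s + k • e)) (σ (s + k • e + e)) : ℝ)) := by
    intro s
    have h0 : 0 ≤ h := (abs_nonneg _).trans (hφ s)
    refine (le_abs_self _).trans ?_
    rw [abs_mul, abs_spinVal_sub]
    have h1 := disagree_le_sum (fun k => σ (s + k • e)) L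
    simp only [zero_smul, add_zero, succ_nsmul, ← add_assoc] at h1
    have h2 : (disagree (σ s) (σ (s + L • e)) : ℝ) ≤
        ∑ k ∈ Finset.range L, (disagree (σ (s + k • e)) (σ (s + k • e + e)) : ℝ) := by
      exact_mod_cast h1
    gcongr
    exact hφ s
  have hsum : ∑ s, ∑ k ∈ Finset.range L, (disagree (σ (s + k • e)) (σ (s + k • e + e)) : ℝ) =
      L * bondCount e σ := by
    rw [Finset.sum_comm]
    have : ∀ k ∈ Finset.range L, ∑ s, (disagree (σ (s + k • e)) (σ (s + k • e + e)) : ℝ) =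
        bondCount e σ := by
      intro k _
      rw [bondCount, Nat.cast_sum]
      exact Equiv.sum_comp (Equiv.addRight (k • e))
        (fun s => (disagree (σ s) (σ (s + e)) : ℝ))
    rw [Finset.sum_congr rfl this]
    simp
  have := Finset.sum_le_sum fun s (_ : s ∈ Finset.univ) => hterm s
  rw [← hdouble, ← Finset.mul_sum, ← Finset.mul_sum, hsum] at this
  linarith

/-- If a configuration is constant on no rectangle of a periodic family whose members overlap in
at most one row or column, then it has at least as many disagreeing bonds as there are
rectangles. -/
theorem mul_le_bondCount {M₁ M₂ N₁ N₂ K₁ K₂ δ₁ δ₂ : ℕ} [NeZero M₁] [NeZero M₂]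
    (hM₁ : N₁ * K₁ = M₁) (hM₂ : N₂ * K₂ = M₂) (hK₁ : 1 ≤ K₁) (hK₂ : 1 ≤ K₂)
    (hδ₁ : δ₁ ≤ 1) (hδ₂ : δ₂ ≤ 1) (c₁ c₂ : ℤ) (σ : ZMod M₁ × ZMod M₂ → ℤˣ)
    (hσ : ∀ n m : ℤ, ∃ x y x' y' : ℕ, x < K₁ + δ₁ ∧ y < K₂ + δ₂ ∧ x' < K₁ + δ₁ ∧ y' < K₂ + δ₂ ∧
      σ (((n * K₁ + c₁ + x : ℤ) : ZMod M₁), ((m * K₂ + c₂ + y : ℤ) : ZMod M₂)) ≠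
      σ (((n * K₁ + c₁ + x' : ℤ) : ZMod M₁), ((m * K₂ + c₂ + y' : ℤ) : ZMod M₂))) :
    N₁ * N₂ ≤ bondCount (1, 0) σ + bondCount (0, 1) σ := by
  set F : ℤ → ℤ → ℕ → ℕ → ℤˣ := fun n m x y =>
    σ (((n * K₁ + c₁ + x : ℤ) : ZMod M₁), ((m * K₂ + c₂ + y : ℤ) : ZMod M₂)) with hF
  -- Shifting the tiling by `δ` leaves the total over the torus unchanged. The cases `δ = 0` and `δ
  -- = δ₂` give the two windows of rows.
  have hH : ∀ δ : ℕ, bondCount (1, 0) σ = ∑ n ∈ Finset.range N₁, ∑ m ∈ Finset.range N₂,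
      ∑ y ∈ Finset.range K₂, ∑ x ∈ Finset.range K₁,
        disagree (F n m x (y + δ)) (F n m (x + 1) (y + δ)) := by
    intro δ
    rw [bondCount, sum_torus_blocks hM₁ hM₂ _ c₁ (c₂ + δ)]
    refine Finset.sum_congr rfl fun n _ => Finset.sum_congr rfl fun m _ => ?_
    rw [Finset.sum_comm]
    refine Finset.sum_congr rfl fun y _ => Finset.sum_congr rfl fun x _ => ?_
    simp only [hF, Prod.mk_add_mk]
    congr 3 <;> push_cast <;> ring_nf
  have hV : ∀ δ : ℕ, bondCount (0, 1) σ = ∑ n ∈ Finset.range N₁, ∑ m ∈ Finset.range N₂,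
      ∑ x ∈ Finset.range K₁, ∑ y ∈ Finset.range K₂,
        disagree (F n m (x + δ) y) (F n m (x + δ) (y + 1)) := by
    intro δ
    rw [bondCount, sum_torus_blocks hM₁ hM₂ _ (c₁ + δ) c₂]
    refine Finset.sum_congr rfl fun n _ => Finset.sum_congr rfl fun m _ => ?_
    refine Finset.sum_congr rfl fun x _ => Finset.sum_congr rfl fun y _ => ?_
    simp only [hF, Prod.mk_add_mk]
    congr 3 <;> push_cast <;> ring_nf
  have hsum : ∑ n ∈ Finset.range N₁, ∑ m ∈ Finset.range N₂, 2 ≤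
      (bondCount (1, 0) σ + bondCount (1, 0) σ) + (bondCount (0, 1) σ + bondCount (0, 1) σ) := by
    have hHH := congrArg₂ (· + ·) (hH 0) (hH δ₂)
    have hVV := congrArg₂ (· + ·) (hV 0) (hV δ₁)
    beta_reduce at hHH hVV
    rw [hHH, hVV]
    simp only [← Finset.sum_add_distrib]
    refine Finset.sum_le_sum fun n _ => Finset.sum_le_sum fun m _ => ?_
    obtain ⟨x, y, x', y', hx, hy, hx', hy', hne⟩ := hσ n m
    have := two_le_rect_disagree (F n m) hK₁ hK₂ hδ₁ hδ₂ hx hy hx' hy' hne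
    simpa only [Finset.sum_add_distrib, add_zero] using this
  simp only [Finset.sum_const, Finset.card_range, smul_eq_mul] at hsum
  nlinarith

/-! The field on the torus. -/

theorem mem_Zplus_iff (L₁ L₂ : ℕ) [NeZero L₁] [NeZero L₂] (t : ℤ × ℤ) :
    t ∈ Zplus L₁ L₂ ↔ Even (t.1 / L₁ + t.2 / L₂) := by
  have h₁ : (0 : ℤ) < L₁ := by exact_mod_cast Nat.pos_of_ne_zero (NeZero.ne L₁)
  have h₂ : (0 : ℤ) < L₂ := by exact_mod_cast Nat.pos_of_ne_zero (NeZero.ne L₂)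
  constructor
  · rintro ⟨n, m, hnm, ha, hb, hc, hd⟩
    have e₁ : t.1 / L₁ = n := le_antisymm
      (Int.lt_add_one_iff.1 (Int.ediv_lt_of_lt_mul h₁ hb)) ((Int.le_ediv_iff_mul_le h₁).2 ha)
    have e₂ : t.2 / L₂ = m := le_antisymm
      (Int.lt_add_one_iff.1 (Int.ediv_lt_of_lt_mul h₂ hd)) ((Int.le_ediv_iff_mul_le h₂).2 hc)
    rwa [e₁, e₂]
  · intro h
    exact ⟨_, _, h, Int.ediv_mul_le _ h₁.ne', Int.lt_ediv_add_one_mul_self _ h₁,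
      Int.ediv_mul_le _ h₂.ne', Int.lt_ediv_add_one_mul_self _ h₂⟩

/-- Reduction modulo `N L` changes the cell index by a multiple of `N`, which is even; the cell
colour is therefore well defined on the torus. -/
theorem even_emod_ediv_add (N L : ℕ) [NeZero L] (hN : Even N) (x b : ℤ) :
    Even (x % ((N * L : ℕ) : ℤ) / L + b) ↔ Even (x / L + b) := by
  have hL : (L : ℤ) ≠ 0 := by exact_mod_cast NeZero.ne L
  have key : x % ((N * L : ℕ) : ℤ) / L = x / L - N * (x / ((N * L : ℕ) : ℤ)) := by
    rw [Int.emod_def]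
    have : x - ((N * L : ℕ) : ℤ) * (x / ((N * L : ℕ) : ℤ)) =
        x + -(N * (x / ((N * L : ℕ) : ℤ))) * L := by
      push_cast
      ring
    rw [this, Int.add_mul_ediv_right _ _ hL]
    ring
  have hN' : Even ((N : ℤ)) := by exact_mod_cast hN
  rw [key, sub_add_eq_add_sub, Int.even_sub]
  simp [hN'.mul_right]

variable {L₁ L₂ N : ℕ}

theorem torusField_toTorus [NeZero L₁] [NeZero L₂] [NeZero N]
    (hN : Even N) (h : ℝ) (t : ℤ × ℤ) :
    torusField L₁ L₂ N h (toTorus L₁ L₂ N t) = field L₁ L₂ h t := by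
  unfold torusField field toTorus
  simp only [mem_Zplus_iff, ZMod.val_intCast]
  congr 1
  rw [eq_iff_iff, even_emod_ediv_add N L₁ hN, add_comm, even_emod_ediv_add N L₂ hN, add_comm]

theorem toTorus_surjective [NeZero L₁] [NeZero L₂] [NeZero N]
    : Function.Surjective (toTorus L₁ L₂ N) := fun s =>
  ⟨(s.1.val, s.2.val), by ext <;> simp [toTorus]⟩

theorem abs_torusField_le {h : ℝ} (hh : 0 ≤ h) (s : Torus L₁ L₂ N) :
    |torusField L₁ L₂ N h s| ≤ h := by
  unfold torusField field
  split_ifs <;> simp [abs_of_nonneg hh]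

theorem torusField_add_left [NeZero L₁] [NeZero L₂] [NeZero N]
    (hN : Even N) (h : ℝ) (s : Torus L₁ L₂ N) :
    torusField L₁ L₂ N h (s + L₁ • ((1, 0) : Torus L₁ L₂ N)) = -torusField L₁ L₂ N h s := by
  obtain ⟨t, rfl⟩ := toTorus_surjective s
  have hs : toTorus L₁ L₂ N t + L₁ • ((1, 0) : Torus L₁ L₂ N) =
      toTorus L₁ L₂ N (t.1 + 1 * L₁, t.2) := by
    ext <;> simp [toTorus]
  rw [hs, torusField_toTorus hN, torusField_toTorus hN]
  have hL : (L₁ : ℤ) ≠ 0 := by exact_mod_cast NeZero.ne L₁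
  simp only [field, mem_Zplus_iff, Int.add_mul_ediv_right _ _ hL, add_right_comm _ (1 : ℤ),
    Int.even_add_one]
  split_ifs <;> simp

theorem torusField_add_right [NeZero L₁] [NeZero L₂] [NeZero N]
    (hN : Even N) (h : ℝ) (s : Torus L₁ L₂ N) :
    torusField L₁ L₂ N h (s + L₂ • ((0, 1) : Torus L₁ L₂ N)) = -torusField L₁ L₂ N h s := by
  obtain ⟨t, rfl⟩ := toTorus_surjective s
  have hs : toTorus L₁ L₂ N t + L₂ • ((0, 1) : Torus L₁ L₂ N) =
      toTorus L₁ L₂ N (t.1, t.2 + 1 * L₂) := by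
    ext <;> simp [toTorus]
  rw [hs, torusField_toTorus hN, torusField_toTorus hN]
  have hL : (L₂ : ℤ) ≠ 0 := by exact_mod_cast NeZero.ne L₂
  simp only [field, mem_Zplus_iff, Int.add_mul_ediv_right _ _ hL, ← add_assoc,
    Int.even_add_one]
  split_ifs <;> simp

/-! Energy estimates. -/

theorem hamiltonian_eq [NeZero L₁] [NeZero L₂] [NeZero N]
    (J h : ℝ) (σ : Config L₁ L₂ N) :
    hamiltonian L₁ L₂ N J h σ = -2 * J * Fintype.card (Torus L₁ L₂ N) +
      2 * J * ((bondCount (1, 0) σ + bondCount (0, 1) σ : ℕ) : ℝ) -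
      ∑ s, torusField L₁ L₂ N h s * spinVal (σ s) := by
  have hbond : ∑ s : Torus L₁ L₂ N, (spinVal (σ s) * spinVal (σ (s + (1, 0))) +
      spinVal (σ s) * spinVal (σ (s + (0, 1)))) = 2 * Fintype.card (Torus L₁ L₂ N) -
      2 * ((bondCount (1, 0) σ + bondCount (0, 1) σ : ℕ) : ℝ) := by
    simp only [spinVal_mul, bondCount, Finset.sum_add_distrib, Finset.sum_sub_distrib,
      ← Finset.mul_sum, Finset.sum_const, Finset.card_univ, nsmul_eq_mul, mul_one]
    push_cast
    ring
  rw [hamiltonian, hbond]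
  ring

theorem sum_field_le [NeZero L₁] [NeZero L₂] [NeZero N]
    (hN : Even N) {h : ℝ} (hh : 0 ≤ h) (σ : Config L₁ L₂ N) :
    ∑ s, torusField L₁ L₂ N h s * spinVal (σ s) ≤
      h * L₁ * L₂ / (L₁ + L₂) * ((bondCount (1, 0) σ + bondCount (0, 1) σ : ℕ) : ℝ) := by
  have h₁ : (0 : ℝ) < L₁ := by exact_mod_cast Nat.pos_of_ne_zero (NeZero.ne L₁)
  have h₂ : (0 : ℝ) < L₂ := by exact_mod_cast Nat.pos_of_ne_zero (NeZero.ne L₂)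
  have e₁ := sum_antiperiodic_le (1, 0) L₁ _ (abs_torusField_le hh) (torusField_add_left hN h) σ
  have e₂ := sum_antiperiodic_le (0, 1) L₂ _ (abs_torusField_le hh) (torusField_add_right hN h) σ
  rw [div_mul_eq_mul_div, le_div_iff₀ (by positivity)]
  push_cast
  nlinarith [mul_le_mul_of_nonneg_left e₁ h₂.le, mul_le_mul_of_nonneg_left e₂ h₁.le]

theorem le_hamiltonian [NeZero L₁] [NeZero L₂] [NeZero N]
    (hN : Even N) {J h : ℝ} (hh : 0 ≤ h)
    (hκ : 0 ≤ 2 * J - h * L₁ * L₂ / (L₁ + L₂)) (σ : Config L₁ L₂ N) {n : ℕ}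
    (hn : n ≤ bondCount (1, 0) σ + bondCount (0, 1) σ) :
    -2 * J * Fintype.card (Torus L₁ L₂ N) + (2 * J - h * L₁ * L₂ / (L₁ + L₂)) * n ≤
      hamiltonian L₁ L₂ N J h σ := by
  have h1 := sum_field_le hN hh σ
  have h2 : (n : ℝ) ≤ ((bondCount (1, 0) σ + bondCount (0, 1) σ : ℕ) : ℝ) := by exact_mod_cast hn
  rw [hamiltonian_eq]
  nlinarith [mul_le_mul_of_nonneg_left h2 hκ]

/-- The two constant configurations have opposite field energies, so one of them has energy at most
`-2J|𝕋|`. -/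
theorem le_partitionFn [NeZero L₁] [NeZero L₂] [NeZero N]
    {β : ℝ} (hβ : 0 ≤ β) (J h : ℝ) :
    Real.exp (-β * (-2 * J * Fintype.card (Torus L₁ L₂ N))) ≤ partitionFn L₁ L₂ N J h β := by
  obtain ⟨u, hu⟩ : ∃ u : ℤˣ, 0 ≤ ∑ s, torusField L₁ L₂ N h s * spinVal u := by
    rcases le_total 0 (∑ s, torusField L₁ L₂ N h s) with h0 | h0
    · exact ⟨1, by simpa [spinVal] using h0⟩
    · exact ⟨-1, by simpa [spinVal] using h0⟩
  have hsingle := Finset.single_le_sum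
    (f := fun σ : Config L₁ L₂ N => Real.exp (-β * hamiltonian L₁ L₂ N J h σ))
    (fun _ _ => (Real.exp_pos _).le) (Finset.mem_univ fun _ => u)
  refine le_trans (Real.exp_le_exp.2 ?_) hsingle
  rw [hamiltonian_eq]
  simp only [bondCount, disagree, if_true, Finset.sum_const_zero]
  push_cast
  nlinarith [mul_nonneg hβ hu]

theorem gibbsProb_le [NeZero L₁] [NeZero L₂] [NeZero N]
    {J h β : ℝ} (hβ : 0 ≤ β) {κ n : ℝ}
    (A : Set (Config L₁ L₂ N)) (hA : ∀ σ ∈ A,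
      -2 * J * Fintype.card (Torus L₁ L₂ N) + κ * n ≤ hamiltonian L₁ L₂ N J h σ) :
    gibbsProb L₁ L₂ N J h β A ≤
      2 ^ Fintype.card (Torus L₁ L₂ N) * Real.exp (-β * (κ * n)) := by
  have hZ := le_partitionFn (L₁ := L₁) (L₂ := L₂) (N := N) hβ J h
  have hZ0 := (Real.exp_pos _).trans_le hZ
  have hterm : ∀ σ : Config L₁ L₂ N,
      A.indicator (gibbs L₁ L₂ N J h β) σ ≤ Real.exp (-β * (κ * n)) := by
    intro σ
    by_cases hσ : σ ∈ A
    · rw [Set.indicator_of_mem hσ, gibbs, div_le_iff₀ hZ0]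
      calc Real.exp (-β * hamiltonian L₁ L₂ N J h σ)
          ≤ Real.exp (-β * (κ * n) + -β * (-2 * J * Fintype.card (Torus L₁ L₂ N))) :=
            Real.exp_le_exp.2 (by nlinarith [mul_le_mul_of_nonneg_left (hA σ hσ) hβ])
        _ = Real.exp (-β * (κ * n)) * Real.exp (-β * (-2 * J * Fintype.card (Torus L₁ L₂ N))) :=
            Real.exp_add _ _
        _ ≤ _ := by gcongr
    · rw [Set.indicator_of_notMem hσ]
      exact (Real.exp_pos _).le
  calc gibbsProb L₁ L₂ N J h β A
      ≤ ∑ _σ : Config L₁ L₂ N, Real.exp (-β * (κ * n)) :=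
        Finset.sum_le_sum fun σ _ => hterm σ
    _ = _ := by
        simp only [Finset.sum_const, Finset.card_univ, nsmul_eq_mul, Fintype.card_fun,
          Fintype.card_units_int]
        push_cast
        rfl

/-! Rectangles and their propagation. -/

/-- The rectangle of `a × b` sites with lower left corner `lo`. -/
def rect (lo : ℤ × ℤ) (a b : ℕ) : Set (ℤ × ℤ) :=
  {t | lo.1 ≤ t.1 ∧ t.1 < lo.1 + a ∧ lo.2 ≤ t.2 ∧ t.2 < lo.2 + b}

/-- The equations for `c` say that the reflections are in the bisecting lines of the rectangle and
so preserve it. Propagation therefore amounts to translating the rectangle, whatever the parities of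
`p`. -/
theorem exists_ne_of_mem_propagator {lo c : ℤ × ℤ} {a b : ℕ} (hc₁ : c.1 = 2 * lo.1 + a - 1)
    (hc₂ : c.2 = 2 * lo.2 + b - 1) {pos p : ℤ × ℤ} {σ : Config L₁ L₂ N}
    (hσ : σ ∈ propagator L₁ L₂ N pos c p '' badEvent L₁ L₂ N (toTorus L₁ L₂ N '' rect lo a b)) :
    ∃ x y x' y' : ℕ, x < a ∧ y < b ∧ x' < a ∧ y' < b ∧
      σ (toTorus L₁ L₂ N (pos.1 + lo.1 + x, pos.2 + lo.2 + y)) ≠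
      σ (toTorus L₁ L₂ N (pos.1 + lo.1 + x', pos.2 + lo.2 + y')) := by
  obtain ⟨τ, hτ, rfl⟩ := hσ
  set σ := propagator L₁ L₂ N pos c p τ with hσdef
  have hval : ∀ t ∈ rect lo a b, ∃ x y : ℕ, x < a ∧ y < b ∧
      σ (toTorus L₁ L₂ N (pos.1 + lo.1 + x, pos.2 + lo.2 + y)) = τ (toTorus L₁ L₂ N t) := by
    rintro ⟨t₁, t₂⟩ ⟨h₁, h₂, h₃, h₄⟩
    simp only at h₁ h₂ h₃ h₄
    obtain ⟨x, hx⟩ := Int.eq_ofNat_of_zero_le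
      (show 0 ≤ (if Odd p.1 then c.1 - t₁ else t₁) - lo.1 by split_ifs <;> omega)
    obtain ⟨y, hy⟩ := Int.eq_ofNat_of_zero_le
      (show 0 ≤ (if Odd p.2 then c.2 - t₂ else t₂) - lo.2 by split_ifs <;> omega)
    refine ⟨x, y, by split_ifs at hx <;> omega, by split_ifs at hy <;> omega, ?_⟩
    rw [add_assoc, add_assoc, show lo.1 + (x : ℤ) = if Odd p.1 then c.1 - t₁ else t₁ by omega,
      show lo.2 + (y : ℤ) = if Odd p.2 then c.2 - t₂ else t₂ by omega]
    simp only [hσdef, propagator, translate]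
    split_ifs <;> simp [reflect₁, reflect₂, toTorus]
  have hbad : ¬ ((∀ s ∈ toTorus L₁ L₂ N '' rect lo a b, τ s = 1) ∨
    (∀ s ∈ toTorus L₁ L₂ N '' rect lo a b, τ s = -1)) := hτ
  push Not at hbad
  obtain ⟨⟨_, ⟨t, ht, rfl⟩, hne⟩, ⟨_, ⟨t', ht', rfl⟩, hne'⟩⟩ := hbad
  obtain ⟨x, y, hx, hy, h⟩ := hval t ht
  obtain ⟨x', y', hx', hy', h'⟩ := hval t' ht'
  refine ⟨x, y, x', y', hx, hy, hx', hy', ?_⟩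
  rw [h, h', (Int.units_eq_one_or _).resolve_left hne, (Int.units_eq_one_or _).resolve_right hne']
  decide

theorem ncard_positions {N₁ N₂ K₁ K₂ : ℕ} [NeZero (N * L₁)] [NeZero (N * L₂)]
    (hM₁ : N₁ * K₁ = N * L₁) (hM₂ : N₂ * K₂ = N * L₂) (c : ℤ × ℤ) :
    (Set.range fun p : ℤ × ℤ => toTorus L₁ L₂ N (p.1 * K₁ + c.1, p.2 * K₂ + c.2)).ncard =
      N₁ * N₂ := by
  rw [← ncard_range_zmod hM₁ c.1, ← ncard_range_zmod hM₂ c.2, ← Set.ncard_prod,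
    Set.range_prodMap.symm]
  rfl

/-- The chessboard bound for a periodic family of rectangles. -/
theorem rect_bound [NeZero L₁] [NeZero L₂] [NeZero N]
    {J h β : ℝ} (hh : 0 ≤ h) (hβ : 0 ≤ β)
    (hκ : 0 ≤ 2 * J - h * L₁ * L₂ / (L₁ + L₂)) (hN : Even N)
    {N₁ N₂ K₁ K₂ δ₁ δ₂ B : ℕ} (hM₁ : N₁ * K₁ = N * L₁) (hM₂ : N₂ * K₂ = N * L₂)
    (hδ₁ : δ₁ ≤ 1) (hδ₂ : δ₂ ≤ 1) (hB : K₁ * K₂ ≤ B) {lo c c₀ : ℤ × ℤ}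
    (hc₁ : c.1 = 2 * lo.1 + (K₁ + δ₁ : ℕ) - 1) (hc₂ : c.2 = 2 * lo.2 + (K₂ + δ₂ : ℕ) - 1)
    {pos : ℤ × ℤ → ℤ × ℤ} (hpos : ∀ p, pos p = (p.1 * K₁ + c₀.1, p.2 * K₂ + c₀.2)) :
    gibbsProb L₁ L₂ N J h β (⋂ p : ℤ × ℤ, propagator L₁ L₂ N (pos p) c p ''
        badEvent L₁ L₂ N (toTorus L₁ L₂ N '' rect lo (K₁ + δ₁) (K₂ + δ₂))) ^
        (1 / ((Set.range fun p : ℤ × ℤ => toTorus L₁ L₂ N (pos p)).ncard : ℝ)) ≤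
      2 ^ B * Real.exp (-β * (2 * J - h * L₁ * L₂ / (L₁ + L₂))) := by
  have hNL₁ : N * L₁ ≠ 0 := mul_ne_zero (NeZero.ne N) (NeZero.ne L₁)
  have hNL₂ : N * L₂ ≠ 0 := mul_ne_zero (NeZero.ne N) (NeZero.ne L₂)
  have hN₁ : N₁ ≠ 0 := left_ne_zero_of_mul (hM₁ ▸ hNL₁)
  have hN₂ : N₂ ≠ 0 := left_ne_zero_of_mul (hM₂ ▸ hNL₂)
  have hK₁ : 1 ≤ K₁ := Nat.pos_of_ne_zero (right_ne_zero_of_mul (hM₁ ▸ hNL₁))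
  have hK₂ : 1 ≤ K₂ := Nat.pos_of_ne_zero (right_ne_zero_of_mul (hM₂ ▸ hNL₂))
  set κ : ℝ := 2 * J - h * L₁ * L₂ / (L₁ + L₂)
  simp only [hpos]
  rw [ncard_positions hM₁ hM₂ c₀]
  set n := N₁ * N₂ with hn
  have hn0 : n ≠ 0 := mul_ne_zero hN₁ hN₂
  set A := ⋂ p : ℤ × ℤ, propagator L₁ L₂ N (p.1 * K₁ + c₀.1, p.2 * K₂ + c₀.2) c p ''
        badEvent L₁ L₂ N (toTorus L₁ L₂ N '' rect lo (K₁ + δ₁) (K₂ + δ₂)) with hAdef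
  have hP : gibbsProb L₁ L₂ N J h β A ≤
      2 ^ Fintype.card (Torus L₁ L₂ N) * Real.exp (-β * (κ * n)) := by
    refine gibbsProb_le hβ A fun σ hσ => le_hamiltonian hN hh hκ σ ?_
    refine mul_le_bondCount hM₁ hM₂ hK₁ hK₂ hδ₁ hδ₂ (c₀.1 + lo.1) (c₀.2 + lo.2) σ fun i j => ?_
    have := exists_ne_of_mem_propagator hc₁ hc₂ (Set.mem_iInter.1 hσ (i, j))
    simpa only [toTorus, add_assoc] using this
  -- The `K₁ × K₂` period cells tile the torus exactly, even where the rectangles themselves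
  -- overlap.
  have hcard : Fintype.card (Torus L₁ L₂ N) ≤ B * n := by
    rw [Fintype.card_prod, ZMod.card, ZMod.card, ← hM₁, ← hM₂]
    calc N₁ * K₁ * (N₂ * K₂) = K₁ * K₂ * n := by rw [hn]; ring
      _ ≤ B * n := Nat.mul_le_mul_right _ hB
  have hP0 : 0 ≤ gibbsProb L₁ L₂ N J h β A := by
    refine Finset.sum_nonneg fun σ _ => Set.indicator_nonneg (fun σ _ => ?_) σ
    exact div_nonneg (Real.exp_pos _).le
      ((Real.exp_pos _).le.trans (le_partitionFn hβ J h))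
  have hPn : gibbsProb L₁ L₂ N J h β A ≤ (2 ^ B * Real.exp (-β * κ)) ^ n := by
    refine hP.trans ?_
    rw [mul_pow, ← pow_mul, ← Real.exp_nat_mul]
    have hexp : -β * (κ * n) = n * (-β * κ) := by ring
    rw [hexp]
    gcongr
    norm_num
  calc gibbsProb L₁ L₂ N J h β A ^ (1 / (n : ℝ))
      ≤ ((2 ^ B * Real.exp (-β * κ)) ^ n) ^ (1 / (n : ℝ)) :=
        Real.rpow_le_rpow hP0 hPn (by positivity)
    _ = _ := by
        rw [one_div, Real.pow_rpow_inv_natCast (by positivity) hn0]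

/-! Blocks and double-blocks as rectangles. -/

/-- The lower left corner of the block. -/
def blockCorner (L₁ L₂ : ℕ) : ℤ × ℤ := (-((L₁ + 1) / 2 : ℕ), -((L₂ + 1) / 2 : ℕ))

theorem blockSide_eq (L : ℕ) : blockSide L = L + L % 2 := by
  unfold blockSide
  split_ifs with h
  · rw [Nat.even_iff.1 h, add_zero]
  · rw [Nat.not_even_iff.1 h]

/-- The overlap of neighbouring blocks is `L % 2`: none for even `L`, one row or column for odd `L`.
-/
theorem block_eq : block L₁ L₂ N =
    toTorus L₁ L₂ N '' rect (blockCorner L₁ L₂) (L₁ + L₁ % 2) (L₂ + L₂ % 2) := by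
  unfold block
  congr 1
  ext ⟨x, y⟩
  simp only [rect, blockCorner, Set.mem_ofPred_eq, abs_le]
  omega

theorem image_toTorus_add (V : Set (ℤ × ℤ)) (a : ℤ × ℤ) :
    (fun s => s + toTorus L₁ L₂ N a) '' (toTorus L₁ L₂ N '' V) =
      toTorus L₁ L₂ N '' ((fun t => t + a) '' V) := by
  rw [Set.image_image, Set.image_image]
  refine Set.image_congr fun t _ => ?_
  simp [toTorus]

/-- The two blocks are adjacent or share one column, so the union has no gap. Label `two` adds a
block on the left, which moves the corner by `-L₁`. -/
theorem rect_union_horizontal (L₁ L₂ : ℕ) (i : Label) :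
    rect (blockCorner L₁ L₂) (L₁ + L₁ % 2) (L₂ + L₂ % 2) ∪
      (fun t => t + doubleShift L₁ L₂ .horizontal i) ''
        rect (blockCorner L₁ L₂) (L₁ + L₁ % 2) (L₂ + L₂ % 2) =
    rect (blockCorner L₁ L₂ - (i.offset * L₁, 0)) (2 * L₁ + L₁ % 2) (L₂ + L₂ % 2) := by
  ext ⟨x, y⟩
  rw [Set.image_add_right]
  cases i <;> simp [rect, blockCorner, doubleShift, Label.sign, Label.offset] <;> omega

theorem rect_union_vertical (L₁ L₂ : ℕ) (i : Label) :
    rect (blockCorner L₁ L₂) (L₁ + L₁ % 2) (L₂ + L₂ % 2) ∪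
      (fun t => t + doubleShift L₁ L₂ .vertical i) ''
        rect (blockCorner L₁ L₂) (L₁ + L₁ % 2) (L₂ + L₂ % 2) =
    rect (blockCorner L₁ L₂ - (0, i.offset * L₂)) (L₁ + L₁ % 2) (2 * L₂ + L₂ % 2) := by
  ext ⟨x, y⟩
  rw [Set.image_add_right]
  cases i <;> simp [rect, blockCorner, doubleShift, Label.sign, Label.offset] <;> omega

end CellBoard

theorem proposition2 (L₁ L₂ : ℕ) [NeZero L₁] [NeZero L₂] (J h β : ℝ)
    (hJ : 0 < J) (hh : 0 < h) (hβ : 0 < β)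
    (hPeierls : h < 2 * J / (L₁ : ℝ) + 2 * J / (L₂ : ℝ)) :
    (∀ (N : ℕ) [NeZero N], Even N →
      CellBoard.z L₁ L₂ N J h β
          (CellBoard.badEvent L₁ L₂ N (CellBoard.block L₁ L₂ N)) ≤
        2 ^ (CellBoard.blockSide L₁ * CellBoard.blockSide L₂) *
          Real.exp (-β * (2 * J - h * (L₁ : ℝ) * (L₂ : ℝ) / ((L₁ : ℝ) + (L₂ : ℝ))))) ∧
    (∀ (N : ℕ) [NeZero N], 4 ∣ N → ∀ (d : CellBoard.Dir) (i j : CellBoard.Label),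
      CellBoard.zDouble L₁ L₂ N J h β d i j
          (CellBoard.badEvent L₁ L₂ N (CellBoard.doubleBlock L₁ L₂ N d i)) ≤
        4 ^ (CellBoard.blockSide L₁ * CellBoard.blockSide L₂) *
          Real.exp (-β * (2 * J - h * (L₁ : ℝ) * (L₂ : ℝ) / ((L₁ : ℝ) + (L₂ : ℝ))))) := by
  have h₁ : (0 : ℝ) < L₁ := by exact_mod_cast Nat.pos_of_ne_zero (NeZero.ne L₁)
  have h₂ : (0 : ℝ) < L₂ := by exact_mod_cast Nat.pos_of_ne_zero (NeZero.ne L₂)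
  -- Multiplied by `L₁ L₂`, the hypothesis reads `h L₁ L₂ < 2J (L₁ + L₂)`.
  have hκ : 0 ≤ 2 * J - h * L₁ * L₂ / (L₁ + L₂) := by
    rw [sub_nonneg, div_le_iff₀ (by positivity)]
    rw [div_add_div _ _ h₁.ne' h₂.ne', lt_div_iff₀ (by positivity)] at hPeierls
    nlinarith
  have hB : L₁ * L₂ ≤ CellBoard.blockSide L₁ * CellBoard.blockSide L₂ := by
    rw [CellBoard.blockSide_eq, CellBoard.blockSide_eq]
    exact Nat.mul_le_mul (Nat.le_add_right _ _) (Nat.le_add_right _ _)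
  have hδ : ∀ L : ℕ, L % 2 ≤ 1 := fun L => by omega
  refine ⟨fun N _ hN => ?_, fun N _ hN d i j => ?_⟩
  · rw [CellBoard.block_eq]
    refine CellBoard.rect_bound hh.le hβ.le hκ hN rfl rfl (hδ L₁) (hδ L₂) hB (c₀ := (0, 0))
      ?_ ?_ fun p => ?_
    · simp only [CellBoard.blockCorner]
      omega
    · simp only [CellBoard.blockCorner]
      omega
    · simp [CellBoard.blockPos]
  · have hN2 : Even N := even_iff_two_dvd.2 (dvd_trans (by norm_num) hN)
    have hhalf : N / 2 * 2 = N := Nat.div_mul_cancel hN2.two_dvd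
    -- A period cell of the double-block family has `2 L₁ L₂` sites, which doubles the exponent of
    -- `2`.
    have h4 : (4 : ℝ) ^ (CellBoard.blockSide L₁ * CellBoard.blockSide L₂) =
        2 ^ (2 * (CellBoard.blockSide L₁ * CellBoard.blockSide L₂)) := by
      rw [pow_mul (2 : ℝ)]
      norm_num
    rw [h4, CellBoard.doubleBlock, CellBoard.block_eq, CellBoard.image_toTorus_add,
      ← Set.image_union]
    cases d
    · rw [CellBoard.rect_union_horizontal]
      refine CellBoard.rect_bound (N₁ := N / 2) (K₁ := 2 * L₁) (c₀ := (-(j.offset * L₁), 0))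
        hh.le hβ.le hκ hN2 (by rw [← mul_assoc, hhalf]) rfl (hδ L₁) (hδ L₂) (by nlinarith)
        ?_ ?_ fun p => ?_
      · cases i <;> simp [CellBoard.blockCorner, CellBoard.doubleCentre, CellBoard.doubleShift,
          CellBoard.Label.sign, CellBoard.Label.offset] <;> omega
      · simp [CellBoard.blockCorner, CellBoard.doubleCentre, CellBoard.doubleShift]
        omega
      · simp [CellBoard.doublePos]
        ring
    · rw [CellBoard.rect_union_vertical]
      refine CellBoard.rect_bound (N₂ := N / 2) (K₂ := 2 * L₂) (c₀ := (0, -(j.offset * L₂)))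
        hh.le hβ.le hκ hN2 rfl (by rw [← mul_assoc, hhalf]) (hδ L₁) (hδ L₂) (by nlinarith)
        ?_ ?_ fun p => ?_
      · simp [CellBoard.blockCorner, CellBoard.doubleCentre, CellBoard.doubleShift]
        omega
      · cases i <;> simp [CellBoard.blockCorner, CellBoard.doubleCentre, CellBoard.doubleShift,
          CellBoard.Label.sign, CellBoard.Label.offset] <;> omega
      · simp [CellBoard.doublePos]
        ring
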